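/- All graphs are finite and simple. A cover of a graph $G$ is a pair $\mathcal{H}=(L,H)$ consisting of a graph $H$ and a function $L$ assigning to each vertex of $G$ a set of vertices of $H$ such that: the sets $L(u)$, $u\in V(G)$, form a partition of $V(H)$ into $|V(G)|$ (nonempty) parts; $H[L(u)]$ is complete for every $u\in V(G)$; if $H$ has an edge between $L(u)$ and $L(v)$, then $u=v$ or $uv\in E(G)$; and if $uv\in E(G)$, then the edges of $H$ between $L(u)$ and $L(v)$ form a (possibly empty) matching. The cover is $m$-fold if $|L(u)|=m$ for all $u\in V(G)$. An $\mathcal{H}$-coloring of $G$ is an independent set of $H$ of size $|V(G)|$. The DP color function $P_{DP}(G,m)$ is the minimum, over all $m$-fold covers $\mathcal{H}$ of $G$, of the number of $\mathcal{H}$-colorings of $G$. **Proposition.** Let $n_1,n_2\ge 3$, let $G_1=C_{n_1}$ and $G_2=C_{n_2}$ be vertex-disjoint cycles on $n_1$ and $n_2$ vertices, and let $u_iv_i\in E(G_i)$ for $i=1,2$. Let $G$ be the graph obtained from the union of $G_1$ and $G_2$ by identifying $u_1$ with $u_2$ and $v_1$ with $v_2$. Then for every integer $m\ge 3$: if $n_1$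 and $n_2$ are both even, then $$P_{DP}(G,m)=\frac{1}{m}\left((m-1)^{n_1+n_2-1}-(m-1)^{n_1-1}-(m-1)^{n_2-1}-m-1\right);$$ otherwise, $$P_{DP}(G,m)=\frac{P_{DP}(G_1,m)\,P_{DP}(G_2,m)}{m(m-1)}.$$ -/

import Mathlib

/-- A cover `(L, H)` of the graph `G`, where `H` is a graph with vertex set `W`. -/
structure DPCover {V W : Type*} (G : SimpleGraph V) where
  /-- the graph of the cover -/
  H : SimpleGraph W
  /-- the list of each vertex of `G` -/
  L : V → Set W
  /-- the lists form a partition of the vertex set of `H` -/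
  isPartition : Setoid.IsPartition (Set.range L)
  /-- the partition has exactly one part for each vertex of `G` -/
  injective : Function.Injective L
  /-- each list induces a complete graph -/
  isClique : ∀ u, H.IsClique (L u)
  /-- edges of `H` run inside a list or between lists of adjacent vertices -/
  adj_of_cross : ∀ u v, ∀ x ∈ L u, ∀ y ∈ L v, H.Adj x y → u = v ∨ G.Adj u v
  /-- for `uv` an edge of `G`, the edges between `L u` and `L v` form a matching
  (the clause is used for both orders of `u` and `v`) -/
  matching : ∀ u v, G.Adj u v → ∀ x ∈ L u, ∀ y ∈ L v, ∀ z ∈ L v,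
    H.Adj x y → H.Adj x z → y = z

namespace DPCover

variable {V W : Type*} {G : SimpleGraph V}

/-- The cover is `m`-fold: every list has exactly `m` elements. -/
def IsFold (C : DPCover (W := W) G) (m : ℕ) : Prop :=
  ∀ u, (C.L u).encard = m

/-- The colorings of a cover: independent sets of `H` of size `|V(G)|`. -/
def colorings (C : DPCover (W := W) G) : Set (Set W) :=
  {I | C.H.IsIndepSet I ∧ I.encard = ENat.card V}

/-- The number of colorings of a cover. -/
noncomputable def numColorings (C : DPCover (W := W) G) : ℕ :=
  C.colorings.ncard

end DPCover

/-- The numbers of colorings of the `m`-fold covers of `G`. For a finite graph `G`, every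
`m`-fold cover is isomorphic to one whose (finite) vertex set lives in `Type`. -/
def dpCounts {V : Type*} (G : SimpleGraph V) (m : ℕ) : Set ℕ :=
  {k | ∃ (W : Type) (_ : Finite W) (C : DPCover (W := W) G), C.IsFold m ∧ C.numColorings = k}

/-- The DP color function of a finite graph: the minimum number of colorings over all
`m`-fold covers (for `m ≥ 1`; see `dpCounts_nonempty` for the existence of the minimum). -/
noncomputable def dpColorFunction {V : Type*} (G : SimpleGraph V) (m : ℕ) : ℕ :=
  sInf (dpCounts G m)

/-- A finite graph has `m`-fold covers for each `m ≥ 1`. -/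
theorem dpCounts_nonempty {V : Type*} [Finite V] (G : SimpleGraph V) {m : ℕ} (hm : 1 ≤ m) :
    (dpCounts G m).Nonempty := by
  obtain ⟨n, ⟨e⟩⟩ := Finite.exists_equiv_fin V
  refine ⟨_, Fin n × Fin m, inferInstance, {
    H := { Adj := fun x y => x ≠ y ∧ x.1 = y.1
           symm := ⟨fun x y h => ⟨h.1.symm, h.2.symm⟩⟩
           loopless := ⟨fun x h => h.1 rfl⟩ }
    L := fun u => {x | x.1 = e u}
    isPartition := ?_
    injective := ?_
    isClique := ?_
    adj_of_cross := ?_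
    matching := ?_ }, ?_, rfl⟩
  · refine ⟨?_, fun a => ⟨{x | x.1 = a.1}, ⟨⟨e.symm a.1, by simp⟩, rfl⟩, ?_⟩⟩
    · rintro ⟨u, hu⟩
      have h : ((e u, ⟨0, hm⟩) : Fin n × Fin m) ∈ {x : Fin n × Fin m | x.1 = e u} := rfl
      exact (Set.ext_iff.mp hu _).mp h
    · rintro _ ⟨⟨u, rfl⟩, h⟩
      have h' : a.1 = e u := h
      simp [h']
  · intro u v h
    have h1 : ((e u, ⟨0, hm⟩) : Fin n × Fin m) ∈ {x : Fin n × Fin m | x.1 = e u} := rfl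
    have h2 : {x : Fin n × Fin m | x.1 = e u} = {x | x.1 = e v} := h
    rw [h2] at h1
    exact e.injective h1
  · intro u x hx y hy hxy
    exact ⟨hxy, Eq.trans hx (Eq.symm hy)⟩
  · intro u v x hx y hy h
    exact Or.inl (e.injective ((Eq.symm hx).trans (h.2.trans hy)))
  · intro u v huv x hx y hy z hz h _
    exact absurd (e.injective ((Eq.symm hx).trans (h.2.trans hy))) huv.ne
  · intro u
    have h : {x : Fin n × Fin m | x.1 = e u} = (fun j => (e u, j)) '' Set.univ := by
      ext ⟨a, b⟩
      simp [eq_comm]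
    change Set.encard {x : Fin n × Fin m | x.1 = e u} = m
    rw [h, Set.InjOn.encard_image (by intro a _ b _ hab; simpa using hab)]
    simp [Set.encard_univ]

/-- The identifications `u₁ ∼ u₂` and `v₁ ∼ v₂` on the disjoint union of two vertex sets. -/
inductive GlueRel {V₁ V₂ : Type*} (u₁ v₁ : V₁) (u₂ v₂ : V₂) : V₁ ⊕ V₂ → V₁ ⊕ V₂ → Prop
  | fst : GlueRel u₁ v₁ u₂ v₂ (Sum.inl u₁) (Sum.inr u₂)
  | snd : GlueRel u₁ v₁ u₂ v₂ (Sum.inl v₁) (Sum.inr v₂)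

/-- The graph obtained from the disjoint union of `G₁` and `G₂` by identifying `u₁` with `u₂`
and `v₁` with `v₂`. -/
def edgeGluing {V₁ V₂ : Type*} (G₁ : SimpleGraph V₁) (G₂ : SimpleGraph V₂)
    (u₁ v₁ : V₁) (u₂ v₂ : V₂) : SimpleGraph (Quot (GlueRel u₁ v₁ u₂ v₂)) :=
  (G₁.sum G₂).map (Quot.mk _)

/-! Enlarging the matchings of a cover to perfect ones only destroys colorings, so it suffices to
minimize over covers given by a permutation on each edge (`exists_voltage_card_le`,
`dpColorFunction_le_voltage`). On a path with `a` edges and end colors `x`, `y` there are `A +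
(-1)^a [σ x = y]` colorings, where `A = pathCoeff m a` and `σ` is the product of the permutations
along the path (`ncard_pathColorings`).

In the glued graph, fix the color `x` of one end of the common edge and sum over the color of the
other end. Let `p = σ x` and `q = τ x` come from the two long paths, with `a` and `b` edges, and let
`r` be the color forbidden by the common edge. With `B = pathCoeff m b`, the sum is `(m-1)AB +
(-1)^a B [p ≠ r] + (-1)^b A [q ≠ r] + (-1)^(a+b) [p = q ≠ r]`. It depends only on coincidences among
`p`, `q`, `r`, so it can be minimized separately for each `x`; the minimum is attained globally once
permutations realize the optimal pattern at every `x` (`dpColorFunction_edgeGluing_cycleGraph_eq`).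

A cycle on `a + 1` vertices is even exactly when `a` is odd. Odd `a` favors `p ≠ r` (a derangement),
even `a` favors `p = r` (the identity). If `a` and `b` are both odd, two derangements that never
agree also avoid the last term, which pushes the count below the product formula; in the other cases
the product formula holds. -/

open Equiv

/-! ### Reduction to covers by perfect matchings -/

/-- A family of permutations indexed by ordered pairs of vertices that describes a cover of `G`
by perfect matchings: reversing an edge inverts its permutation. -/
def IsVoltage {V : Type*} {m : ℕ} (G : SimpleGraph V) (f : V → V → Perm (Fin m)) : Prop :=
  ∀ u v, G.Adj u v → f v u = (f u v)⁻¹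

/-- The colorings of the cover of `G` described by the permutations `f`. -/
def voltageColorings {V : Type*} {m : ℕ} (G : SimpleGraph V) (f : V → V → Perm (Fin m)) :
    Set (V → Fin m) :=
  {c | ∀ u v, G.Adj u v → f u v (c u) ≠ c v}

/-- A relation on `Fin m` that is a matching is contained in the graph of a permutation. -/
theorem exists_perm_extending_matching {m : ℕ} (R : Fin m → Fin m → Prop)
    (hr : ∀ i j k, R i j → R i k → j = k) (hl : ∀ i j k, R i k → R j k → i = j) :
    ∃ σ : Perm (Fin m), ∀ i j, R i j → σ i = j := by
  classical
  -- The value off the domain of `R` is irrelevant: `g` is only extended from that domain.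
  let g : Fin m → Fin m := fun i => if h : ∃ j, R i j then h.choose else i
  have hg : ∀ i j, R i j → g i = j := by
    intro i j h
    have h' : ∃ j, R i j := ⟨j, h⟩
    simp only [g, dif_pos h']
    exact hr _ _ _ h'.choose_spec h
  have hinj : Set.InjOn g {i | ∃ j, R i j} := by
    rintro i ⟨j, hj⟩ k ⟨l, hl'⟩ h
    rw [hg _ _ hj, hg _ _ hl'] at h
    subst h
    exact hl _ _ _ hj hl'
  obtain ⟨e, he⟩ := Set.MapsTo.exists_equiv_extend_of_card_eq (t := Finset.univ)
    (by simp) (fun i _ => by simp : Set.MapsTo g {i | ∃ j, R i j} _) hinj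
  refine ⟨e.trans (Equiv.subtypeUnivEquiv (by simp)), fun i j h => ?_⟩
  have := he i ⟨j, h⟩
  rw [hg _ _ h] at this
  simpa using this

namespace DPCover

variable {V W : Type*} {G : SimpleGraph V}

theorem eq_of_mem_of_mem (C : DPCover (W := W) G) {u v : V} {x : W} (hu : x ∈ C.L u)
    (hv : x ∈ C.L v) : u = v :=
  C.injective ((C.isPartition.2 x).unique ⟨⟨u, rfl⟩, hu⟩ ⟨⟨v, rfl⟩, hv⟩)

/-- Every fold cover has at least as many colorings as some cover by perfect matchings. -/
theorem exists_voltage_card_le [Finite V] [Finite W] (C : DPCover (W := W) G) {m : ℕ}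
    (hC : C.IsFold m) : ∃ f : V → V → Perm (Fin m), IsVoltage G f ∧
      (voltageColorings G f).ncard ≤ C.numColorings := by
  classical
  have hcard : ∀ u, Nonempty (Fin m ≃ C.L u) := fun u => by
    have h1 : Nat.card (C.L u) = m := by
      have h := hC u
      rw [Nat.card_coe_set_eq, Set.ncard_def, h]
      rfl
    exact ⟨(Finite.equivFinOfCardEq h1).symm⟩
  let e : ∀ u, Fin m ≃ C.L u := fun u => (hcard u).some
  have hext : ∀ u v, ∃ σ : Perm (Fin m), G.Adj u v → ∀ i j, C.H.Adj (e u i) (e v j) → σ i = j := by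
    intro u v
    by_cases h : G.Adj u v
    · obtain ⟨σ, hσ⟩ := exists_perm_extending_matching (fun i j => C.H.Adj (e u i) (e v j))
        (fun i j k hj hk => (e v).injective (Subtype.ext
          (C.matching u v h _ (e u i).2 _ (e v j).2 _ (e v k).2 hj hk)))
        (fun i j k hi hj => (e u).injective (Subtype.ext
          (C.matching v u h.symm _ (e v k).2 _ (e u i).2 _ (e u j).2 hi.symm hj.symm)))
      exact ⟨σ, fun _ => hσ⟩
    · exact ⟨1, fun h' => absurd h' h⟩
  choose g hg using hext
  obtain ⟨k, ⟨r⟩⟩ := Finite.exists_equiv_fin V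
  -- `g u v` and `g v u` were chosen independently; orienting each edge by an enumeration of `V`
  -- keeps one and inverts it for the reverse direction.
  let f : V → V → Perm (Fin m) := fun u v => if r u < r v then g u v else (g v u)⁻¹
  have hfg : ∀ u v, G.Adj u v → ∀ i j, C.H.Adj (e u i) (e v j) → f u v i = j := by
    intro u v h i j hij
    by_cases hr : r u < r v
    · simpa only [f, if_pos hr] using hg u v h i j hij
    · simp only [f, if_neg hr]
      rw [Perm.inv_eq_iff_eq, hg v u h.symm j i hij.symm]
  refine ⟨f, ?_, ?_⟩
  · intro u v h
    have hne : r u ≠ r v := fun h' => h.ne (r.injective h')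
    rcases lt_or_gt_of_ne hne with hr | hr
    · simp [f, hr, hr.not_gt]
    · simp [f, hr, hr.not_gt]
  · let I : (V → Fin m) → Set W := fun c => Set.range fun u => (e u (c u) : W)
    have hinj : ∀ c : V → Fin m, Function.Injective fun u => (e u (c u) : W) := fun c u v h =>
      C.eq_of_mem_of_mem (e u (c u)).2
        (by rw [show (e u (c u) : W) = e v (c v) from h]; exact (e v (c v)).2)
    refine Set.ncard_le_ncard_of_injOn I ?_ ?_ (Set.toFinite _)
    · intro c hc
      refine ⟨?_, ?_⟩
      · rintro _ ⟨u, rfl⟩ _ ⟨v, rfl⟩ hne hadj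
        rcases C.adj_of_cross u v _ (e u (c u)).2 _ (e v (c v)).2 hadj with rfl | h
        · exact hne rfl
        · exact hc u v h (hfg u v h _ _ hadj)
      · change (Set.range fun u => (e u (c u) : W)).encard = _
        rw [← Set.image_univ, (hinj c).encard_image, Set.encard_univ]
    · intro c _ d _ hcd
      funext u
      obtain ⟨v, hv⟩ : (e u (c u) : W) ∈ I d := hcd ▸ ⟨u, rfl⟩
      have huv : v = u := C.eq_of_mem_of_mem (e v (d v)).2
        (by rw [show (e v (d v) : W) = e u (c u) from hv]; exact (e u (c u)).2)
      subst huv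
      exact ((e v).injective (Subtype.ext hv)).symm

end DPCover

/-- The number of colorings of a cover by perfect matchings bounds the DP color function. -/
theorem dpColorFunction_le_voltage {V : Type} [Finite V] {G : SimpleGraph V} {m : ℕ} (hm : 1 ≤ m)
    {f : V → V → Perm (Fin m)} (hf : IsVoltage G f) :
    dpColorFunction G m ≤ (voltageColorings G f).ncard := by
  classical
  have hadj : ∀ {u v}, G.Adj u v → ∀ i j, f u v i = j ↔ f v u j = i := by
    intro u v h i j
    rw [hf u v h, Perm.inv_eq_iff_eq, eq_comm]
  let C : DPCover (W := V × Fin m) G :=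
    { H := { Adj := fun x y => (x.1 = y.1 ∧ x.2 ≠ y.2) ∨ (G.Adj x.1 y.1 ∧ f x.1 y.1 x.2 = y.2)
             symm := ⟨fun x y h => h.imp (fun h => ⟨h.1.symm, h.2.symm⟩)
               (fun h => ⟨h.1.symm, (hadj h.1 _ _).1 h.2⟩)⟩
             loopless := ⟨fun x h => h.elim (fun h => h.2 rfl) (fun h => h.1.ne rfl)⟩ }
      L := fun u => {x | x.1 = u}
      isPartition := by
        refine ⟨?_, fun a => ⟨{x | x.1 = a.1}, ⟨⟨a.1, rfl⟩, rfl⟩, ?_⟩⟩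
        · rintro ⟨u, hu⟩
          exact (Set.ext_iff.mp hu (u, ⟨0, hm⟩)).mp rfl
        · rintro _ ⟨⟨u, rfl⟩, h⟩
          have h' : a.1 = u := h
          simp [h']
      injective := fun u v h => (Set.ext_iff.mp h (u, ⟨0, hm⟩)).mp rfl
      isClique := fun u x hx y hy hxy =>
        Or.inl ⟨hx.trans hy.symm, fun h => hxy (Prod.ext (hx.trans hy.symm) h)⟩
      adj_of_cross := by
        rintro u v x rfl y rfl (h | h)
        exacts [Or.inl h.1, Or.inr h.1]
      matching := by
        rintro u v huv x rfl y rfl z hz (h | h) (h' | h')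
        · exact absurd h.1 huv.ne
        · exact absurd h.1 huv.ne
        · exact absurd (h'.1.trans hz) huv.ne
        · have hz' : z.1 = y.1 := hz
          refine Prod.ext hz'.symm ?_
          rw [← h.2, ← h'.2, hz'] }
  have hfold : C.IsFold m := by
    intro u
    have h : C.L u = (fun j => (u, j)) '' Set.univ := by
      ext ⟨a, b⟩
      simp [C, eq_comm]
    rw [h, Set.InjOn.encard_image (by intro a _ b _ hab; simpa using hab)]
    simp [Set.encard_univ]
  -- Lists are cliques, so an independent set of size `|V|` meets each list exactly once and is the
  -- graph of a function.
  have hsub : C.colorings ⊆ (fun c : V → Fin m => Set.range fun u => (u, c u)) ''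
      voltageColorings G f := by
    rintro I ⟨hI, hcard⟩
    have hinj : Set.InjOn Prod.fst I := by
      intro x hx y hy hxy
      by_contra hne
      exact hI hx hy hne (Or.inl ⟨hxy, fun h => hne (Prod.ext hxy h)⟩)
    have hsurj : Prod.fst '' I = Set.univ := by
      refine Set.Finite.eq_of_subset_of_encard_le (Set.toFinite _) (Set.subset_univ _) ?_
      rw [hinj.encard_image, hcard, Set.encard_univ]
    have hex : ∀ u, ∃ i, (u, i) ∈ I := fun u => by
      obtain ⟨⟨a, b⟩, h, rfl⟩ : u ∈ Prod.fst '' I := hsurj ▸ Set.mem_univ u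
      exact ⟨b, h⟩
    choose c hc using hex
    refine ⟨c, fun u v huv h => ?_, ?_⟩
    · exact hI (hc u) (hc v) (fun h => huv.ne (congrArg Prod.fst h)) (Or.inr ⟨huv, h⟩)
    · ext x
      constructor
      · rintro ⟨u, rfl⟩
        exact hc u
      · exact fun hx => ⟨x.1, hinj (hc _) hx rfl⟩
  have hle : dpColorFunction G m ≤ C.numColorings :=
    Nat.sInf_le ⟨V × Fin m, inferInstance, C, hfold, rfl⟩
  refine hle.trans ?_
  exact (Set.ncard_le_ncard hsub (Set.toFinite _)).trans (Set.ncard_image_le (Set.toFinite _))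

/-- The DP color function is attained by a cover by perfect matchings. -/
theorem exists_voltage_eq_dpColorFunction {V : Type} [Finite V] (G : SimpleGraph V) {m : ℕ}
    (hm : 1 ≤ m) : ∃ f : V → V → Perm (Fin m), IsVoltage G f ∧
      (voltageColorings G f).ncard = dpColorFunction G m := by
  obtain ⟨W, _, C, hC, h⟩ := Nat.sInf_mem (dpCounts_nonempty G hm)
  obtain ⟨f, hf, hle⟩ := C.exists_voltage_card_le hC
  exact ⟨f, hf, le_antisymm (hle.trans h.le) (dpColorFunction_le_voltage hm hf)⟩

/-! ### Counting colorings of a path with prescribed ends -/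

theorem Equiv.Perm.inv_apply_eq_iff {α : Type*} (σ : Perm α) (x y : α) : σ⁻¹ y = x ↔ σ x = y := by
  rw [Perm.inv_eq_iff_eq, eq_comm]

theorem Nat.card_eq_sum_card_fiber {α β : Type*} [Finite α] [Fintype β] (F : α → β) :
    Nat.card α = ∑ z, Nat.card {c // F c = z} := by
  rw [Nat.card_congr (Equiv.sigmaFiberEquiv F).symm, Nat.card_sigma]

/-- The colorings of a path with `a` edges whose ends are colored `x` and `y`, in the cover given
by the permutations `g`. -/
def pathColorings {m a : ℕ} (g : Fin a → Perm (Fin m)) (x y : Fin m) :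
    Set (Fin (a + 1) → Fin m) :=
  {c | c 0 = x ∧ c (Fin.last a) = y ∧ ∀ i : Fin a, g i (c i.castSucc) ≠ c i.succ}

/-- The number of proper `m`-colorings of a path with `a` edges whose ends have prescribed
distinct colors. -/
def pathCoeff (m : ℤ) : ℕ → ℤ
  | 0 => 0
  | a + 1 => (m - 1) * pathCoeff m a + (-1) ^ a

theorem mul_pathCoeff (m : ℤ) (a : ℕ) : m * pathCoeff m a = (m - 1) ^ a - (-1) ^ a := by
  induction a with
  | zero => simp [pathCoeff]
  | succ a ih =>
    rw [pathCoeff, mul_add, mul_left_comm, ih]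
    ring

/-- This positivity lets a term `A` or `B` of the weight absorb the correction `±1` when the weight
is minimized. -/
theorem one_le_pathCoeff {m : ℤ} (hm : 3 ≤ m) {a : ℕ} (ha : 1 ≤ a) : 1 ≤ pathCoeff m a := by
  induction a, ha using Nat.le_induction with
  | base => simp [pathCoeff]
  | succ a _ ih =>
    rw [pathCoeff]
    have h : (-1 : ℤ) ≤ (-1) ^ a := by
      rcases neg_one_pow_eq_or ℤ a with h | h <;> simp [h]
    nlinarith

theorem ncard_pathColorings_succ {m a : ℕ} (g : Fin (a + 1) → Perm (Fin m)) (x y : Fin m) :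
    (pathColorings g x y).ncard =
      ∑ z, if g 0 x = z then 0 else (pathColorings (Fin.tail g) z y).ncard := by
  rw [← Nat.card_coe_set_eq, Nat.card_eq_sum_card_fiber (fun c => c.1 1)]
  refine Finset.sum_congr rfl fun z _ => ?_
  split_ifs with h
  · refine Nat.card_eq_zero.2 (Or.inl ⟨?_⟩)
    rintro ⟨⟨c, hx, hy, hc⟩, hz⟩
    refine hc 0 ?_
    change c 1 = z at hz
    simp [hx, h, hz]
  · rw [← Nat.card_coe_set_eq]
    refine Nat.card_congr
      { toFun := fun c => ⟨Fin.tail c.1.1, c.2, c.1.2.2.1, fun i => c.1.2.2.2 i.succ⟩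
        invFun := fun c => ⟨⟨Fin.cons x c.1, rfl, c.2.2.1, ?_⟩, c.2.1⟩
        left_inv := ?_
        right_inv := fun c => rfl }
    · refine Fin.cases ?_ fun i => ?_
      · change g 0 x ≠ c.1 0
        rwa [c.2.1]
      · exact c.2.2.2 i
    · rintro ⟨⟨c, rfl, hc⟩, hz⟩
      exact Subtype.ext (Subtype.ext (Fin.cons_self_tail c))

/-- One transfer step: forbidding one color replaces `[w = z]` by `1 - [w = z]`, which is the source
of the alternating sign. -/
theorem sum_ne_add_ite {m : ℕ} (A s : ℤ) (z w : Fin m) :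
    ∑ y, (if z = y then 0 else A + s * if w = y then 1 else 0) =
      ((m : ℤ) - 1) * A + s * if w = z then 0 else 1 := by
  have h : ∀ y, (if z = y then 0 else A + s * if w = y then 1 else 0) =
      A + (s * if w = y then 1 else 0) - if z = y then A + s * (if w = z then 1 else 0) else 0 := by
    intro y
    by_cases hz : z = y
    · subst hz
      simp
    · simp [hz]
  rw [Finset.sum_congr rfl fun y _ => h y]
  simp only [Finset.sum_sub_distrib, Finset.sum_add_distrib, ← Finset.mul_sum,
    Finset.sum_ite_eq, Finset.mem_univ, if_true, Finset.sum_const, Finset.card_univ,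
    Fintype.card_fin, nsmul_eq_mul]
  split_ifs <;> ring

/-- Induction on the first edge: `sum_ne_add_ite` preserves the shape "constant plus signed
indicator", and the constants obey the recursion of `pathCoeff`. -/
theorem ncard_pathColorings {m a : ℕ} (g : Fin a → Perm (Fin m)) (x y : Fin m) :
    ((pathColorings g x y).ncard : ℤ) =
      pathCoeff m a + (-1) ^ a * if (List.ofFn g).reverse.prod x = y then 1 else 0 := by
  induction a generalizing x with
  | zero =>
    simp only [pathCoeff, List.ofFn_zero, List.reverse_nil, List.prod_nil, Perm.one_apply,
      pow_zero, one_mul, zero_add]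
    split_ifs with h
    · have : pathColorings g x y = {fun _ => x} := by
        ext c
        simp only [pathColorings, Set.mem_ofPred_eq, Set.mem_singleton_iff]
        constructor
        · rintro ⟨h0, -⟩
          funext i
          rw [show i = 0 from Fin.ext (by omega), h0]
        · rintro rfl
          exact ⟨rfl, h, fun i => i.elim0⟩
      simp [this]
    · have : pathColorings g x y = ∅ := by
        ext c
        simp only [pathColorings, Set.mem_ofPred_eq, Set.mem_empty_iff_false, iff_false]
        rintro ⟨h0, h1, -⟩
        exact h (h0.symm.trans h1)
      simp [this]
  | succ a ih =>
    rw [ncard_pathColorings_succ]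
    push_cast
    simp only [ih]
    -- Moving the product over to `y` turns the indicator into one in the summation variable `z`, as
    -- `sum_ne_add_ite` requires.
    have hp : ∀ z, ((List.ofFn (Fin.tail g)).reverse.prod z = y) =
        ((List.ofFn (Fin.tail g)).reverse.prod⁻¹ y = z) := fun z =>
      propext (Perm.inv_apply_eq_iff _ _ _).symm
    simp only [hp]
    rw [sum_ne_add_ite, pathCoeff, List.ofFn_succ, List.reverse_cons, List.prod_append,
      List.prod_singleton]
    have hq : ((List.ofFn (fun i : Fin a => g i.succ)).reverse.prod * g 0) x = y ↔
        (List.ofFn (Fin.tail g)).reverse.prod⁻¹ y = g 0 x := by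
      rw [Perm.inv_eq_iff_eq, eq_comm]
      rfl
    simp only [hq]
    split_ifs <;> ring

/-! ### Cycles with prescribed colors on an edge -/

/-- The colorings of the cover of `G` given by `f` in which `u` and `v` are colored `x` and `y`. -/
def endColorings {V : Type*} {m : ℕ} (G : SimpleGraph V) (f : V → V → Perm (Fin m)) (u v : V)
    (x y : Fin m) : Set (V → Fin m) :=
  {c | c ∈ voltageColorings G f ∧ c u = x ∧ c v = y}

theorem endColorings_swap {V : Type*} {m : ℕ} (G : SimpleGraph V) (f : V → V → Perm (Fin m))
    (u v : V) (x y : Fin m) : endColorings G f u v x y = endColorings G f v u y x := by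
  ext c
  simp only [endColorings, Set.mem_ofPred_eq]
  tauto

theorem cycleGraph_adj_iff {a : ℕ} (ha : 1 ≤ a) (u v : Fin (a + 1)) :
    (SimpleGraph.cycleGraph (a + 1)).Adj u v ↔ v + 1 = u ∨ u + 1 = v := by
  obtain ⟨b, rfl⟩ := Nat.exists_eq_add_of_le' ha
  rw [SimpleGraph.cycleGraph_adj, sub_eq_iff_eq_add, sub_eq_iff_eq_add, add_comm 1, add_comm 1,
    eq_comm, @eq_comm _ v]

/-- Deleting the edge `uv` leaves the path `u, u + 1, …, v` with `a` edges; the deleted edge only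
forbids one pair of end colors. -/
theorem ncard_endColorings_cycleGraph_of_add_one {m a : ℕ} (ha : 1 ≤ a)
    {f : Fin (a + 1) → Fin (a + 1) → Perm (Fin m)}
    (hf : IsVoltage (SimpleGraph.cycleGraph (a + 1)) f) {u v : Fin (a + 1)} (huv : v + 1 = u)
    (x y : Fin m) :
    (endColorings (SimpleGraph.cycleGraph (a + 1)) f u v x y).ncard =
      if f u v x = y then 0 else
        (pathColorings (fun i : Fin a => f (u + i.castSucc) (u + i.succ)) x y).ncard := by
  have hadj : (SimpleGraph.cycleGraph (a + 1)).Adj u v := (cycleGraph_adj_iff ha u v).2 (Or.inl huv)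
  have hlast : u + Fin.last a = v := by
    rw [← huv, add_assoc, add_comm 1, Fin.last_add_one, add_zero]
  split_ifs with h
  · rw [Set.ncard_eq_zero]
    ext c
    simp only [endColorings, Set.mem_ofPred_eq, Set.mem_empty_iff_false, iff_false]
    rintro ⟨hc, rfl, rfl⟩
    exact hc u v hadj h
  · rw [← Nat.card_coe_set_eq, ← Nat.card_coe_set_eq]
    refine Nat.card_congr (((Equiv.addLeft u).arrowCongr (Equiv.refl (Fin m))).symm.subtypeEquiv ?_)
    intro c
    simp only [Equiv.arrowCongr_symm, Equiv.refl_symm]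
    change c ∈ endColorings _ f u v x y ↔ (c (u + 0) = x ∧ c (u + Fin.last a) = y ∧
      ∀ i : Fin a, f (u + i.castSucc) (u + i.succ) (c (u + i.castSucc)) ≠ c (u + i.succ))
    rw [add_zero, hlast]
    constructor
    · rintro ⟨hc, hx, hy⟩
      refine ⟨hx, hy, fun i => hc _ _ ((cycleGraph_adj_iff ha _ _).2 (Or.inr ?_))⟩
      rw [add_assoc, Fin.coeSucc_eq_succ]
    · rintro ⟨hx, hy, hc⟩
      refine ⟨?_, hx, hy⟩
      have key : ∀ p, f p (p + 1) (c p) ≠ c (p + 1) := by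
        intro p
        -- In coordinates based at `u`, the last `j` gives the closing edge from `v` to `u`; every
        -- other `j` gives an edge of the path.
        obtain ⟨j, rfl⟩ : ∃ j, p = u + j := ⟨p - u, by abel⟩
        induction j using Fin.lastCases with
        | last =>
          rw [hlast, huv, hf u v hadj, Ne, Perm.inv_eq_iff_eq, hx, hy]
          exact fun h' => h h'.symm
        | cast i =>
          rw [add_assoc, Fin.coeSucc_eq_succ]
          exact hc i
      intro p q hpq
      rcases (cycleGraph_adj_iff ha _ _).1 hpq with rfl | rfl
      · rw [hf _ _ hpq.symm, Ne, Perm.inv_eq_iff_eq]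
        exact fun h' => key q h'.symm
      · exact key p

/-- The number of colorings of a cycle with prescribed colors on an edge. -/
theorem exists_perm_ncard_endColorings_cycleGraph {m a : ℕ} (ha : 1 ≤ a)
    {f : Fin (a + 1) → Fin (a + 1) → Perm (Fin m)}
    (hf : IsVoltage (SimpleGraph.cycleGraph (a + 1)) f) {u v : Fin (a + 1)}
    (huv : (SimpleGraph.cycleGraph (a + 1)).Adj u v) :
    ∃ σ : Perm (Fin m), ∀ x y,
      ((endColorings (SimpleGraph.cycleGraph (a + 1)) f u v x y).ncard : ℤ) =
        if f u v x = y then 0 else pathCoeff m a + (-1) ^ a * if σ x = y then 1 else 0 := by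
  rcases (cycleGraph_adj_iff ha u v).1 huv with h | h
  · refine ⟨(List.ofFn fun i : Fin a => f (u + i.castSucc) (u + i.succ)).reverse.prod,
      fun x y => ?_⟩
    rw [ncard_endColorings_cycleGraph_of_add_one ha hf h]
    push_cast
    rw [ncard_pathColorings]
  · refine ⟨(List.ofFn fun i : Fin a => f (v + i.castSucc) (v + i.succ)).reverse.prod⁻¹,
      fun x y => ?_⟩
    rw [endColorings_swap, ncard_endColorings_cycleGraph_of_add_one ha hf h]
    push_cast
    rw [ncard_pathColorings, hf u v huv]
    simp only [Perm.inv_apply_eq_iff]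

theorem exists_voltage_cycleGraph_of_add_one {m a : ℕ} (ha : 2 ≤ a) {u v : Fin (a + 1)}
    (huv : v + 1 = u) (σ : Perm (Fin m)) :
    ∃ f : Fin (a + 1) → Fin (a + 1) → Perm (Fin m),
      IsVoltage (SimpleGraph.cycleGraph (a + 1)) f ∧ f u v = 1 ∧ ∀ x y,
      ((endColorings (SimpleGraph.cycleGraph (a + 1)) f u v x y).ncard : ℤ) =
        if x = y then 0 else pathCoeff m a + (-1) ^ a * if σ x = y then 1 else 0 := by
  obtain ⟨b, rfl⟩ := Nat.exists_eq_add_of_le' ha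
  have h20 : (1 + 1 : Fin (b + 3)) ≠ 0 := by
    simp only [ne_eq, Fin.ext_iff, Fin.val_add, Fin.val_one, Fin.val_zero]
    rw [Nat.mod_eq_of_lt (by omega)]
    omega
  have hv : v ≠ u + 1 := by
    rintro h
    have h' : v = v + (1 + 1) := by rw [← add_assoc, huv, ← h]
    exact h20 (left_eq_add.1 h')
  -- The whole holonomy sits on the first path edge `u, u + 1`. With at least three vertices this
  -- edge differs from `uv`, which stays trivial.
  let f : Fin (b + 3) → Fin (b + 3) → Perm (Fin m) := fun p q =>
    if p = u ∧ q = u + 1 then σ else if p = u + 1 ∧ q = u then σ⁻¹ else 1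
  have hf : IsVoltage (SimpleGraph.cycleGraph (b + 3)) f := by
    intro p q _
    simp only [f]
    by_cases h1 : p = u ∧ q = u + 1
    · obtain ⟨rfl, rfl⟩ := h1
      simp
    · by_cases h2 : p = u + 1 ∧ q = u
      · obtain ⟨rfl, rfl⟩ := h2
        simp
      · rw [if_neg h1, if_neg h2, if_neg (fun h => h2 ⟨h.2, h.1⟩), if_neg (fun h => h1 ⟨h.2, h.1⟩),
          inv_one]
  have hfuv : f u v = 1 := by
    simp [f, hv]
  refine ⟨f, hf, hfuv, fun x y => ?_⟩
  rw [ncard_endColorings_cycleGraph_of_add_one (by omega) hf huv, hfuv, Perm.one_apply, Nat.cast_ite,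
    Nat.cast_zero, ncard_pathColorings]
  have hprod : (List.ofFn fun i : Fin (b + 2) => f (u + i.castSucc) (u + i.succ)).reverse.prod
      = σ := by
    have h1 : ∀ i : Fin (b + 1), f (u + i.succ.castSucc) (u + i.succ.succ) = 1 := by
      intro i
      have e1 : u + i.succ.castSucc ≠ u := fun h =>
        Fin.succ_ne_zero i.castSucc (add_eq_left.1 h)
      have e2 : u + i.succ.succ ≠ u := fun h =>
        Fin.succ_ne_zero i.succ (add_eq_left.1 h)
      simp only [f]
      rw [if_neg (fun h => e1 h.1), if_neg (fun h => e2 h.2)]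
    rw [List.ofFn_succ, List.reverse_cons, List.prod_append, List.prod_singleton]
    simp only [h1]
    rw [List.ofFn_const, List.reverse_replicate, List.prod_replicate, one_pow, one_mul]
    simp [f]
  rw [hprod]

/-- Every permutation is the holonomy of a cover of a cycle that is trivial on a given edge. -/
theorem exists_voltage_cycleGraph {m a : ℕ} (ha : 2 ≤ a) {u v : Fin (a + 1)}
    (huv : (SimpleGraph.cycleGraph (a + 1)).Adj u v) (σ : Perm (Fin m)) :
    ∃ f : Fin (a + 1) → Fin (a + 1) → Perm (Fin m),
      IsVoltage (SimpleGraph.cycleGraph (a + 1)) f ∧ f u v = 1 ∧ ∀ x y,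
      ((endColorings (SimpleGraph.cycleGraph (a + 1)) f u v x y).ncard : ℤ) =
        if x = y then 0 else pathCoeff m a + (-1) ^ a * if σ x = y then 1 else 0 := by
  rcases (cycleGraph_adj_iff (by omega) u v).1 huv with h | h
  · exact exists_voltage_cycleGraph_of_add_one ha h σ
  · obtain ⟨f, hf, h1, hc⟩ := exists_voltage_cycleGraph_of_add_one ha h σ⁻¹
    refine ⟨f, hf, by rw [hf v u huv.symm, h1, inv_one], fun x y => ?_⟩
    rw [endColorings_swap, hc]
    simp only [Perm.inv_apply_eq_iff, @eq_comm _ x y]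

/-! ### Covers and colorings of an edge gluing -/

section Gluing

variable {V₁ V₂ : Type} {G₁ : SimpleGraph V₁} {G₂ : SimpleGraph V₂} {u₁ v₁ : V₁} {u₂ v₂ : V₂}

open Classical in
/-- A canonical representative in the disjoint union of each vertex of the gluing. -/
noncomputable def glueRepr (hne : u₂ ≠ v₂) : Quot (GlueRel u₁ v₁ u₂ v₂) → V₁ ⊕ V₂ :=
  Quot.lift (Sum.elim Sum.inl
      fun j => if j = u₂ then Sum.inl u₁ else if j = v₂ then Sum.inl v₁ else Sum.inr j) (by
    rintro _ _ (_ | _)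
    · simp
    · simp [hne.symm])

theorem glue_inl_injective (hne : u₂ ≠ v₂) {i j : V₁}
    (h : Quot.mk (GlueRel u₁ v₁ u₂ v₂) (Sum.inl i) = Quot.mk _ (Sum.inl j)) : i = j :=
  Sum.inl.inj (congrArg (glueRepr hne) h)

theorem glue_inl_eq_inr (hne : u₂ ≠ v₂) {i : V₁} {j : V₂}
    (h : Quot.mk (GlueRel u₁ v₁ u₂ v₂) (Sum.inl i) = Quot.mk _ (Sum.inr j)) :
    (i = u₁ ∧ j = u₂) ∨ (i = v₁ ∧ j = v₂) := by
  have h' := congrArg (glueRepr hne) h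
  simp only [glueRepr, Sum.elim_inl, Sum.elim_inr] at h'
  split_ifs at h' with h1 h2
  · exact Or.inl ⟨Sum.inl.inj h', h1⟩
  · exact Or.inr ⟨Sum.inl.inj h', h2⟩

theorem glue_inr_injective (hne₁ : u₁ ≠ v₁) (hne : u₂ ≠ v₂) {i j : V₂}
    (h : Quot.mk (GlueRel u₁ v₁ u₂ v₂) (Sum.inr i) = Quot.mk _ (Sum.inr j)) : i = j := by
  have h' := congrArg (glueRepr hne) h
  simp only [glueRepr, Sum.elim_inr] at h'
  split_ifs at h' <;> simp_all

theorem edgeGluing_adj_inl (h₂ : u₂ ≠ v₂) {i j : V₁} (h : G₁.Adj i j) :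
    (edgeGluing G₁ G₂ u₁ v₁ u₂ v₂).Adj (Quot.mk _ (Sum.inl i)) (Quot.mk _ (Sum.inl j)) :=
  SimpleGraph.map_adj_apply' (SimpleGraph.sum_adj_inl.2 h) fun h' => h.ne (glue_inl_injective h₂ h')

theorem edgeGluing_adj_inr (h₁ : u₁ ≠ v₁) (h₂ : u₂ ≠ v₂) {i j : V₂} (h : G₂.Adj i j) :
    (edgeGluing G₁ G₂ u₁ v₁ u₂ v₂).Adj (Quot.mk _ (Sum.inr i)) (Quot.mk _ (Sum.inr j)) :=
  SimpleGraph.map_adj_apply' (SimpleGraph.sum_adj_inr.2 h)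
    fun h' => h.ne (glue_inr_injective h₁ h₂ h')

theorem edgeGluing_adj_cases {p q : Quot (GlueRel u₁ v₁ u₂ v₂)}
    (h : (edgeGluing G₁ G₂ u₁ v₁ u₂ v₂).Adj p q) :
    (∃ i j, G₁.Adj i j ∧ Quot.mk _ (Sum.inl i) = p ∧ Quot.mk _ (Sum.inl j) = q) ∨
      ∃ i j, G₂.Adj i j ∧ Quot.mk _ (Sum.inr i) = p ∧ Quot.mk _ (Sum.inr j) = q := by
  obtain ⟨-, (i | i), (j | j), hij, hp, hq⟩ := h
  · exact Or.inl ⟨i, j, SimpleGraph.sum_adj_inl.1 hij, hp, hq⟩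
  · simp at hij
  · simp at hij
  · exact Or.inr ⟨i, j, SimpleGraph.sum_adj_inr.1 hij, hp, hq⟩

variable {m : ℕ} {f : Quot (GlueRel u₁ v₁ u₂ v₂) → Quot (GlueRel u₁ v₁ u₂ v₂) → Perm (Fin m)}
  {f₁ : V₁ → V₁ → Perm (Fin m)} {f₂ : V₂ → V₂ → Perm (Fin m)}

theorem mem_voltageColorings_edgeGluing (h₁ : u₁ ≠ v₁) (h₂ : u₂ ≠ v₂)
    (hf₁ : ∀ i j, G₁.Adj i j → f (Quot.mk _ (Sum.inl i)) (Quot.mk _ (Sum.inl j)) = f₁ i j)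
    (hf₂ : ∀ i j, G₂.Adj i j → f (Quot.mk _ (Sum.inr i)) (Quot.mk _ (Sum.inr j)) = f₂ i j)
    (c : Quot (GlueRel u₁ v₁ u₂ v₂) → Fin m) :
    c ∈ voltageColorings (edgeGluing G₁ G₂ u₁ v₁ u₂ v₂) f ↔
      (fun i => c (Quot.mk _ (Sum.inl i))) ∈ voltageColorings G₁ f₁ ∧
        (fun j => c (Quot.mk _ (Sum.inr j))) ∈ voltageColorings G₂ f₂ := by
  constructor
  · refine fun hc => ⟨fun i j h => ?_, fun i j h => ?_⟩
    · rw [← hf₁ i j h]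
      exact hc _ _ (edgeGluing_adj_inl h₂ h)
    · rw [← hf₂ i j h]
      exact hc _ _ (edgeGluing_adj_inr h₁ h₂ h)
  · rintro ⟨hc₁, hc₂⟩ p q hpq
    rcases edgeGluing_adj_cases hpq with ⟨i, j, h, rfl, rfl⟩ | ⟨i, j, h, rfl, rfl⟩
    · rw [hf₁ i j h]
      exact hc₁ i j h
    · rw [hf₂ i j h]
      exact hc₂ i j h

/-- The colorings of a gluing are the pairs of colorings that agree on the common edge. -/
theorem ncard_voltageColorings_edgeGluing [Finite V₁] [Finite V₂] (h₁ : u₁ ≠ v₁) (h₂ : u₂ ≠ v₂)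
    (hf₁ : ∀ i j, G₁.Adj i j → f (Quot.mk _ (Sum.inl i)) (Quot.mk _ (Sum.inl j)) = f₁ i j)
    (hf₂ : ∀ i j, G₂.Adj i j → f (Quot.mk _ (Sum.inr i)) (Quot.mk _ (Sum.inr j)) = f₂ i j) :
    (voltageColorings (edgeGluing G₁ G₂ u₁ v₁ u₂ v₂) f).ncard =
      ∑ x, ∑ y, (endColorings G₁ f₁ u₁ v₁ x y).ncard * (endColorings G₂ f₂ u₂ v₂ x y).ncard := by
  have hu : Quot.mk (GlueRel u₁ v₁ u₂ v₂) (Sum.inr u₂) = Quot.mk _ (Sum.inl u₁) :=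
    (Quot.sound GlueRel.fst).symm
  have hv : Quot.mk (GlueRel u₁ v₁ u₂ v₂) (Sum.inr v₂) = Quot.mk _ (Sum.inl v₁) :=
    (Quot.sound GlueRel.snd).symm
  have hmem := mem_voltageColorings_edgeGluing h₁ h₂ hf₁ hf₂
  rw [← Nat.card_coe_set_eq, Nat.card_eq_sum_card_fiber
    (fun c => (c.1 (Quot.mk _ (Sum.inl u₁)), c.1 (Quot.mk _ (Sum.inl v₁)))), Fintype.sum_prod_type]
  refine Finset.sum_congr rfl fun x _ => Finset.sum_congr rfl fun y _ => ?_
  rw [← Nat.card_coe_set_eq, ← Nat.card_coe_set_eq, ← Nat.card_prod]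
  refine Nat.card_congr
    { toFun := fun c => (⟨fun i => c.1.1 (Quot.mk _ (Sum.inl i)), ((hmem _).1 c.1.2).1,
          congrArg Prod.fst c.2, congrArg Prod.snd c.2⟩,
        ⟨fun j => c.1.1 (Quot.mk _ (Sum.inr j)), ((hmem _).1 c.1.2).2,
          (congrArg c.1.1 hu).trans (congrArg Prod.fst c.2),
          (congrArg c.1.1 hv).trans (congrArg Prod.snd c.2)⟩)
      invFun := fun c => ⟨⟨Quot.lift (Sum.elim c.1.1 c.2.1) ?_, (hmem _).2 ⟨c.1.2.1, c.2.2.1⟩⟩,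
        Prod.ext c.1.2.2.1 c.1.2.2.2⟩
      left_inv := ?_
      right_inv := fun c => rfl }
  · rintro _ _ (_ | _)
    · exact c.1.2.2.1.trans c.2.2.2.1.symm
    · exact c.1.2.2.2.trans c.2.2.2.2.symm
  · rintro ⟨⟨c, hc⟩, h⟩
    refine Subtype.ext (Subtype.ext (funext ?_))
    rintro ⟨i | j⟩ <;> rfl

/-- Covers that agree on the common edge extend to the gluing. -/
theorem exists_voltage_edgeGluing (h₁ : G₁.Adj u₁ v₁) (h₂ : G₂.Adj u₂ v₂)
    (hf₁ : IsVoltage G₁ f₁) (hf₂ : IsVoltage G₂ f₂) (h : f₁ u₁ v₁ = f₂ u₂ v₂) :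
    ∃ f : Quot (GlueRel u₁ v₁ u₂ v₂) → Quot (GlueRel u₁ v₁ u₂ v₂) → Perm (Fin m),
      IsVoltage (edgeGluing G₁ G₂ u₁ v₁ u₂ v₂) f ∧
      (∀ i j, G₁.Adj i j → f (Quot.mk _ (Sum.inl i)) (Quot.mk _ (Sum.inl j)) = f₁ i j) ∧
      ∀ i j, G₂.Adj i j → f (Quot.mk _ (Sum.inr i)) (Quot.mk _ (Sum.inr j)) = f₂ i j := by
  have hex : ∀ p q : Quot (GlueRel u₁ v₁ u₂ v₂), ∃ σ : Perm (Fin m),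
      (∀ i j, G₁.Adj i j → Quot.mk _ (Sum.inl i) = p → Quot.mk _ (Sum.inl j) = q → σ = f₁ i j) ∧
      ∀ i j, G₂.Adj i j → Quot.mk _ (Sum.inr i) = p → Quot.mk _ (Sum.inr j) = q → σ = f₂ i j := by
    intro p q
    by_cases hpq : ∃ i j, G₁.Adj i j ∧ Quot.mk _ (Sum.inl i) = p ∧ Quot.mk _ (Sum.inl j) = q
    · obtain ⟨i, j, hij, rfl, rfl⟩ := hpq
      refine ⟨f₁ i j, fun i' j' _ hi hj => ?_, fun i' j' hij' hi hj => ?_⟩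
      · rw [glue_inl_injective h₂.ne hi, glue_inl_injective h₂.ne hj]
      -- An edge coming from both sides is the common edge: the two families agree on it by `h`, and
      -- on its reversal after inversion.
      · rcases glue_inl_eq_inr h₂.ne hi.symm with ⟨rfl, rfl⟩ | ⟨rfl, rfl⟩ <;>
          rcases glue_inl_eq_inr h₂.ne hj.symm with ⟨rfl, rfl⟩ | ⟨rfl, rfl⟩
        · exact absurd rfl hij.ne
        · exact h
        · rw [hf₁ _ _ h₁, hf₂ _ _ h₂, h]
        · exact absurd rfl hij.ne
    · by_cases hpq' : ∃ i j, G₂.Adj i j ∧ Quot.mk _ (Sum.inr i) = p ∧ Quot.mk _ (Sum.inr j) = q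
      · obtain ⟨i, j, hij, rfl, rfl⟩ := hpq'
        refine ⟨f₂ i j, fun i' j' hij' hi hj => absurd ⟨i', j', hij', hi, hj⟩ hpq,
          fun i' j' _ hi hj => ?_⟩
        rw [glue_inr_injective h₁.ne h₂.ne hi, glue_inr_injective h₁.ne h₂.ne hj]
      · exact ⟨1, fun i' j' hij' hi hj => absurd ⟨i', j', hij', hi, hj⟩ hpq,
          fun i' j' hij' hi hj => absurd ⟨i', j', hij', hi, hj⟩ hpq'⟩
  choose f hfl hfr using hex
  refine ⟨f, fun p q hpq => ?_, fun i j hij => hfl _ _ i j hij rfl rfl,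
    fun i j hij => hfr _ _ i j hij rfl rfl⟩
  rcases edgeGluing_adj_cases hpq with ⟨i, j, hij, hp, hq⟩ | ⟨i, j, hij, hp, hq⟩
  · rw [hfl p q i j hij hp hq, hfl q p j i hij.symm hq hp, hf₁ i j hij]
  · rw [hfr p q i j hij hp hq, hfr q p j i hij.symm hq hp, hf₂ i j hij]

end Gluing

/-! ### Reduction to a minimum over color patterns -/

theorem ncard_voltageColorings_eq_sum {V : Type*} [Finite V] {m : ℕ} (G : SimpleGraph V)
    (f : V → V → Perm (Fin m)) (u v : V) :
    (voltageColorings G f).ncard = ∑ x, ∑ y, (endColorings G f u v x y).ncard := by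
  rw [← Nat.card_coe_set_eq, Nat.card_eq_sum_card_fiber (fun c => (c.1 u, c.1 v)),
    Fintype.sum_prod_type]
  refine Finset.sum_congr rfl fun x _ => Finset.sum_congr rfl fun y _ => ?_
  rw [← Nat.card_coe_set_eq]
  refine Nat.card_congr
    { toFun := fun c => ⟨c.1.1, c.1.2, congrArg Prod.fst c.2, congrArg Prod.snd c.2⟩
      invFun := fun c => ⟨⟨c.1, c.2.1⟩, Prod.ext c.2.2.1 c.2.2.2⟩
      left_inv := fun c => rfl
      right_inv := fun c => rfl }

/-- The count is a sum of `m` terms, one for each color of vertex `0`, so a bound on each term that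
some `σ` attains for all colors is the minimum. -/
theorem dpColorFunction_cycleGraph_eq {m a : ℕ} (hm : 1 ≤ m) (ha : 2 ≤ a) {k : ℤ}
    (hk : ∀ p r : Fin m, k ≤ ((m : ℤ) - 1) * pathCoeff m a + (-1) ^ a * if p = r then 0 else 1)
    (σ : Perm (Fin m))
    (hσ : ∀ x, ((m : ℤ) - 1) * pathCoeff m a + (-1) ^ a * (if σ x = x then 0 else 1) = k) :
    (dpColorFunction (SimpleGraph.cycleGraph (a + 1)) m : ℤ) = m * k := by
  have huv : (SimpleGraph.cycleGraph (a + 1)).Adj 0 1 :=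
    (cycleGraph_adj_iff (by omega) _ _).2 (Or.inr (zero_add 1))
  apply le_antisymm
  · obtain ⟨f, hf, -, hc⟩ := exists_voltage_cycleGraph ha huv σ
    refine (Int.ofNat_le.2 (dpColorFunction_le_voltage hm hf)).trans (le_of_eq ?_)
    rw [ncard_voltageColorings_eq_sum _ _ 0 1]
    push_cast
    simp only [hc, sum_ne_add_ite, hσ]
    simp
  · obtain ⟨f, hf, h⟩ := exists_voltage_eq_dpColorFunction (SimpleGraph.cycleGraph (a + 1)) hm
    obtain ⟨σ, hσ⟩ := exists_perm_ncard_endColorings_cycleGraph (by omega) hf huv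
    rw [← h, ncard_voltageColorings_eq_sum _ _ 0 1]
    push_cast
    simp only [hσ, sum_ne_add_ite]
    calc (m : ℤ) * k = ∑ _x : Fin m, k := by simp
      _ ≤ _ := Finset.sum_le_sum fun x _ => hk _ _

/-- The number of colorings of two cycles glued along an edge that extend a given color of the first
glued vertex, in terms of the colors `p`, `q`, `r` of the second one that correspond to it along the
two paths and along the common edge. -/
def gluedCycleWeight (m : ℤ) (a b : ℕ) {α : Type*} [DecidableEq α] (p q r : α) : ℤ :=
  (m - 1) * (pathCoeff m a * pathCoeff m b)
    + (-1) ^ a * pathCoeff m b * (if p = r then 0 else 1)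
    + (-1) ^ b * pathCoeff m a * (if q = r then 0 else 1)
    + (-1) ^ a * (-1) ^ b * (if p = q ∧ p ≠ r then 1 else 0)

theorem sum_mul_eq_gluedCycleWeight {m : ℕ} (a b : ℕ) (p q r : Fin m) :
    ∑ y, (if r = y then 0 else pathCoeff m a + (-1) ^ a * if p = y then 1 else 0) *
      (if r = y then 0 else pathCoeff m b + (-1) ^ b * if q = y then 1 else 0) =
      gluedCycleWeight m a b p q r := by
  -- Expanding the product gives three sums of the form handled by `sum_ne_add_ite`, since `[p =
  -- y][q = y] = [p = q][p = y]`.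
  have h : ∀ y, (if r = y then 0 else pathCoeff m a + (-1) ^ a * if p = y then 1 else 0) *
      (if r = y then 0 else pathCoeff m b + (-1) ^ b * if q = y then 1 else 0) =
      (if r = y then 0 else pathCoeff m a * pathCoeff m b +
        ((-1) ^ a * pathCoeff m b) * if p = y then 1 else 0) +
      (if r = y then 0 else 0 + ((-1) ^ b * pathCoeff m a) * if q = y then 1 else 0) +
      (if r = y then 0 else 0 +
        ((-1) ^ a * (-1) ^ b * if p = q then 1 else 0) * if p = y then 1 else 0) := by
    intro y
    by_cases hr : r = y
    · simp [hr]
    · by_cases hp : p = y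
      · subst hp
        simp only [hr, if_false, if_true, @eq_comm _ q p]
        split_ifs <;> ring
      · simp only [hr, hp, if_false]
        ring
  rw [Finset.sum_congr rfl fun y _ => h y, Finset.sum_add_distrib, Finset.sum_add_distrib,
    sum_ne_add_ite, sum_ne_add_ite, sum_ne_add_ite, gluedCycleWeight]
  by_cases hpq : p = q <;> by_cases hpr : p = r <;> simp [hpq, hpr]

theorem dpColorFunction_edgeGluing_cycleGraph_eq {m a b : ℕ} (hm : 1 ≤ m) (ha : 2 ≤ a)
    (hb : 2 ≤ b) {u₁ v₁ : Fin (a + 1)} {u₂ v₂ : Fin (b + 1)}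
    (h₁ : (SimpleGraph.cycleGraph (a + 1)).Adj u₁ v₁)
    (h₂ : (SimpleGraph.cycleGraph (b + 1)).Adj u₂ v₂) {k : ℤ}
    (hk : ∀ p q r : Fin m, k ≤ gluedCycleWeight m a b p q r) (σ τ : Perm (Fin m))
    (hστ : ∀ x, gluedCycleWeight m a b (σ x) (τ x) x = k) :
    (dpColorFunction (edgeGluing (SimpleGraph.cycleGraph (a + 1)) (SimpleGraph.cycleGraph (b + 1))
      u₁ v₁ u₂ v₂) m : ℤ) = m * k := by
  apply le_antisymm
  · obtain ⟨f₁, hf₁, he₁, hc₁⟩ := exists_voltage_cycleGraph ha h₁ σ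
    obtain ⟨f₂, hf₂, he₂, hc₂⟩ := exists_voltage_cycleGraph hb h₂ τ
    obtain ⟨f, hf, hl, hr⟩ := exists_voltage_edgeGluing h₁ h₂ hf₁ hf₂ (he₁.trans he₂.symm)
    refine (Int.ofNat_le.2 (dpColorFunction_le_voltage hm hf)).trans (le_of_eq ?_)
    rw [ncard_voltageColorings_edgeGluing h₁.ne h₂.ne hl hr]
    push_cast
    simp only [hc₁, hc₂, sum_mul_eq_gluedCycleWeight, hστ]
    simp
  · obtain ⟨f, hf, h⟩ := exists_voltage_eq_dpColorFunction
      (edgeGluing (SimpleGraph.cycleGraph (a + 1)) (SimpleGraph.cycleGraph (b + 1)) u₁ v₁ u₂ v₂) hm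
    have hf₁ : IsVoltage (SimpleGraph.cycleGraph (a + 1))
        fun i j => f (Quot.mk _ (Sum.inl i)) (Quot.mk _ (Sum.inl j)) :=
      fun i j hij => hf _ _ (edgeGluing_adj_inl h₂.ne hij)
    have hf₂ : IsVoltage (SimpleGraph.cycleGraph (b + 1))
        fun i j => f (Quot.mk _ (Sum.inr i)) (Quot.mk _ (Sum.inr j)) :=
      fun i j hij => hf _ _ (edgeGluing_adj_inr h₁.ne h₂.ne hij)
    obtain ⟨σ, hσ⟩ := exists_perm_ncard_endColorings_cycleGraph (by omega) hf₁ h₁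
    obtain ⟨τ, hτ⟩ := exists_perm_ncard_endColorings_cycleGraph (by omega) hf₂ h₂
    have hu : Quot.mk (GlueRel u₁ v₁ u₂ v₂) (Sum.inr u₂) = Quot.mk _ (Sum.inl u₁) :=
      (Quot.sound GlueRel.fst).symm
    have hv : Quot.mk (GlueRel u₁ v₁ u₂ v₂) (Sum.inr v₂) = Quot.mk _ (Sum.inl v₁) :=
      (Quot.sound GlueRel.snd).symm
    -- Both cycles now carry literally the same permutation on the common edge, so they share the
    -- forbidden color `r`.
    rw [hu, hv] at hτ
    rw [← h, ncard_voltageColorings_edgeGluing h₁.ne h₂.ne (fun _ _ _ => rfl) (fun _ _ _ => rfl)]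
    push_cast
    simp only [hσ, hτ, sum_mul_eq_gluedCycleWeight]
    calc (m : ℤ) * k = ∑ _x : Fin m, k := by simp
      _ ≤ _ := Finset.sum_le_sum fun x _ => hk _ _ _

/-! ### Optimal permutations in each parity case -/

/-- Translations by 1 and 2 modulo `m`; this is where `m ≥ 3` is essential. -/
theorem exists_disjoint_derangements {m : ℕ} (hm : 3 ≤ m) :
    ∃ σ τ : Perm (Fin m), ∀ x, σ x ≠ x ∧ τ x ≠ x ∧ σ x ≠ τ x := by
  obtain ⟨k, rfl⟩ := Nat.exists_eq_add_of_le' hm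
  have h2 : (1 + 1 : Fin (k + 3)) ≠ 0 := by
    simp only [ne_eq, Fin.ext_iff, Fin.val_add, Fin.val_one, Fin.val_zero]
    rw [Nat.mod_eq_of_lt (by omega)]
    omega
  refine ⟨Equiv.addRight 1, Equiv.addRight (1 + 1), fun x => ⟨?_, ?_, ?_⟩⟩
  · simp
  · exact fun h => h2 (add_eq_left.1 h)
  · exact fun h => by simpa using add_left_cancel (a := x) h

theorem dpColorFunction_cycleGraph_of_even {m a : ℕ} (hm : 1 ≤ m) (ha : 2 ≤ a) (h : Even a) :
    (dpColorFunction (SimpleGraph.cycleGraph (a + 1)) m : ℤ) = m * ((m - 1) * pathCoeff m a) := by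
  refine dpColorFunction_cycleGraph_eq hm ha (fun p r => ?_) 1 (fun x => ?_)
  · rw [h.neg_one_pow]
    split_ifs <;> simp
  · simp

theorem dpColorFunction_cycleGraph_of_odd {m a : ℕ} (hm : 3 ≤ m) (ha : 2 ≤ a) (h : Odd a) :
    (dpColorFunction (SimpleGraph.cycleGraph (a + 1)) m : ℤ) =
      m * ((m - 1) * pathCoeff m a - 1) := by
  obtain ⟨σ, _, hσ⟩ := exists_disjoint_derangements hm
  refine dpColorFunction_cycleGraph_eq (by omega) ha (fun p r => ?_) σ (fun x => ?_)
  · rw [h.neg_one_pow]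
    split_ifs <;> simp
  · simp [h.neg_one_pow, (hσ x).1, sub_eq_add_neg]

section

variable {m a b : ℕ} {u₁ v₁ : Fin (a + 1)} {u₂ v₂ : Fin (b + 1)}

theorem dpColorFunction_edgeGluing_of_odd_of_odd (hm : 3 ≤ m) (ha : 2 ≤ a) (hb : 2 ≤ b)
    (h₁ : (SimpleGraph.cycleGraph (a + 1)).Adj u₁ v₁)
    (h₂ : (SimpleGraph.cycleGraph (b + 1)).Adj u₂ v₂) (hao : Odd a) (hbo : Odd b) :
    (dpColorFunction (edgeGluing (SimpleGraph.cycleGraph (a + 1)) (SimpleGraph.cycleGraph (b + 1))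
      u₁ v₁ u₂ v₂) m : ℤ) =
      m * ((m - 1) * (pathCoeff m a * pathCoeff m b) - pathCoeff m b - pathCoeff m a) := by
  have hA : 1 ≤ pathCoeff m a := one_le_pathCoeff (by exact_mod_cast hm) (by omega)
  have hB : 1 ≤ pathCoeff m b := one_le_pathCoeff (by exact_mod_cast hm) (by omega)
  obtain ⟨σ, τ, h⟩ := exists_disjoint_derangements hm
  refine dpColorFunction_edgeGluing_cycleGraph_eq (by omega) ha hb h₁ h₂ (fun p q r => ?_) σ τ
    (fun x => ?_)
  · rw [gluedCycleWeight, hao.neg_one_pow, hbo.neg_one_pow]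
    split_ifs <;> linarith
  · rw [gluedCycleWeight, hao.neg_one_pow, hbo.neg_one_pow, if_neg (h x).1, if_neg (h x).2.1,
      if_neg (fun h' => (h x).2.2 h'.1)]
    ring

theorem dpColorFunction_edgeGluing_of_even_of_odd (hm : 3 ≤ m) (ha : 2 ≤ a) (hb : 2 ≤ b)
    (h₁ : (SimpleGraph.cycleGraph (a + 1)).Adj u₁ v₁)
    (h₂ : (SimpleGraph.cycleGraph (b + 1)).Adj u₂ v₂) (hae : Even a) (hbo : Odd b) :
    (dpColorFunction (edgeGluing (SimpleGraph.cycleGraph (a + 1)) (SimpleGraph.cycleGraph (b + 1))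
      u₁ v₁ u₂ v₂) m : ℤ) =
      m * ((m - 1) * (pathCoeff m a * pathCoeff m b) - pathCoeff m a) := by
  have hA : 1 ≤ pathCoeff m a := one_le_pathCoeff (by exact_mod_cast hm) (by omega)
  have hB : 1 ≤ pathCoeff m b := one_le_pathCoeff (by exact_mod_cast hm) (by omega)
  obtain ⟨σ, _, h⟩ := exists_disjoint_derangements hm
  refine dpColorFunction_edgeGluing_cycleGraph_eq (by omega) ha hb h₁ h₂ (fun p q r => ?_) 1 σ
    (fun x => ?_)
  · rw [gluedCycleWeight, hae.neg_one_pow, hbo.neg_one_pow]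
    by_cases hpr : p = r
    · have hpq : ¬(p = q ∧ p ≠ r) := fun h => h.2 hpr
      rw [if_pos hpr, if_neg hpq]
      split_ifs <;> linarith
    -- For `p ≠ r` the last term may be `-1`, but the term `+B` with `B ≥ 1` compensates.
    · rw [if_neg hpr]
      split_ifs <;> linarith
  · simp [gluedCycleWeight, hae.neg_one_pow, hbo.neg_one_pow, (h x).1]
    ring

theorem dpColorFunction_edgeGluing_of_odd_of_even (hm : 3 ≤ m) (ha : 2 ≤ a) (hb : 2 ≤ b)
    (h₁ : (SimpleGraph.cycleGraph (a + 1)).Adj u₁ v₁)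
    (h₂ : (SimpleGraph.cycleGraph (b + 1)).Adj u₂ v₂) (hao : Odd a) (hbe : Even b) :
    (dpColorFunction (edgeGluing (SimpleGraph.cycleGraph (a + 1)) (SimpleGraph.cycleGraph (b + 1))
      u₁ v₁ u₂ v₂) m : ℤ) =
      m * ((m - 1) * (pathCoeff m a * pathCoeff m b) - pathCoeff m b) := by
  have hA : 1 ≤ pathCoeff m a := one_le_pathCoeff (by exact_mod_cast hm) (by omega)
  have hB : 1 ≤ pathCoeff m b := one_le_pathCoeff (by exact_mod_cast hm) (by omega)
  obtain ⟨σ, _, h⟩ := exists_disjoint_derangements hm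
  refine dpColorFunction_edgeGluing_cycleGraph_eq (by omega) ha hb h₁ h₂ (fun p q r => ?_) σ 1
    (fun x => ?_)
  · rw [gluedCycleWeight, hao.neg_one_pow, hbe.neg_one_pow]
    by_cases hqr : q = r
    · have hpq : ¬(p = q ∧ p ≠ r) := fun h => h.2 (h.1.trans hqr)
      rw [if_pos hqr, if_neg hpq]
      split_ifs <;> linarith
    · rw [if_neg hqr]
      split_ifs <;> linarith
  · simp [gluedCycleWeight, hao.neg_one_pow, hbe.neg_one_pow, (h x).1]
    ring

theorem dpColorFunction_edgeGluing_of_even_of_even (hm : 3 ≤ m) (ha : 2 ≤ a) (hb : 2 ≤ b)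
    (h₁ : (SimpleGraph.cycleGraph (a + 1)).Adj u₁ v₁)
    (h₂ : (SimpleGraph.cycleGraph (b + 1)).Adj u₂ v₂) (hae : Even a) (hbe : Even b) :
    (dpColorFunction (edgeGluing (SimpleGraph.cycleGraph (a + 1)) (SimpleGraph.cycleGraph (b + 1))
      u₁ v₁ u₂ v₂) m : ℤ) = m * ((m - 1) * (pathCoeff m a * pathCoeff m b)) := by
  have hA : 1 ≤ pathCoeff m a := one_le_pathCoeff (by exact_mod_cast hm) (by omega)
  have hB : 1 ≤ pathCoeff m b := one_le_pathCoeff (by exact_mod_cast hm) (by omega)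
  refine dpColorFunction_edgeGluing_cycleGraph_eq (by omega) ha hb h₁ h₂ (fun p q r => ?_) 1 1
    (fun x => ?_)
  · rw [gluedCycleWeight, hae.neg_one_pow, hbe.neg_one_pow]
    split_ifs <;> linarith
  · simp [gluedCycleWeight]

end

theorem mainTheorem4 (n₁ n₂ : ℕ) (hn₁ : 3 ≤ n₁) (hn₂ : 3 ≤ n₂)
    (u₁ v₁ : Fin n₁) (u₂ v₂ : Fin n₂)
    (h₁ : (SimpleGraph.cycleGraph n₁).Adj u₁ v₁) (h₂ : (SimpleGraph.cycleGraph n₂).Adj u₂ v₂)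
    (m : ℕ) (hm : 3 ≤ m) :
    (Even n₁ ∧ Even n₂ →
      (dpColorFunction (edgeGluing (SimpleGraph.cycleGraph n₁) (SimpleGraph.cycleGraph n₂)
          u₁ v₁ u₂ v₂) m : ℚ) =
        (((m : ℚ) - 1) ^ (n₁ + n₂ - 1) - ((m : ℚ) - 1) ^ (n₁ - 1) - ((m : ℚ) - 1) ^ (n₂ - 1)
          - m - 1) / m) ∧
    (¬ (Even n₁ ∧ Even n₂) →
      (dpColorFunction (edgeGluing (SimpleGraph.cycleGraph n₁) (SimpleGraph.cycleGraph n₂)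
          u₁ v₁ u₂ v₂) m : ℚ) =
        (dpColorFunction (SimpleGraph.cycleGraph n₁) m : ℚ) *
          (dpColorFunction (SimpleGraph.cycleGraph n₂) m : ℚ) / ((m : ℚ) * ((m : ℚ) - 1))) := by
  obtain ⟨a, rfl⟩ := Nat.exists_eq_add_of_le' (show 1 ≤ n₁ by omega)
  obtain ⟨b, rfl⟩ := Nat.exists_eq_add_of_le' (show 1 ≤ n₂ by omega)
  have ha : 2 ≤ a := by omega
  have hb : 2 ≤ b := by omega
  have hm0 : (m : ℚ) ≠ 0 := by
    have : m ≠ 0 := by omega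
    exact_mod_cast this
  have hm1 : (m : ℚ) - 1 ≠ 0 := by
    have : (m : ℚ) ≠ 1 := by
      have : m ≠ 1 := by omega
      exact_mod_cast this
    exact sub_ne_zero.2 this
  have hcast : ∀ {k : ℕ} {z : ℤ}, (k : ℤ) = z → (k : ℚ) = z := fun h => by exact_mod_cast h
  constructor
  · rintro ⟨he₁, he₂⟩
    have hao : Odd a := by simpa [Nat.even_add_one] using he₁
    have hbo : Odd b := by simpa [Nat.even_add_one] using he₂
    rw [hcast (dpColorFunction_edgeGluing_of_odd_of_odd hm ha hb h₁ h₂ hao hbo)]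
    have hA := congrArg (Int.cast (R := ℚ)) (mul_pathCoeff m a)
    have hB := congrArg (Int.cast (R := ℚ)) (mul_pathCoeff m b)
    rw [hao.neg_one_pow] at hA
    rw [hbo.neg_one_pow] at hB
    push_cast at hA hB ⊢
    -- For odd exponents `(m-1)^a = mA - 1` and `(m-1)^b = mB - 1`, so the claim becomes a
    -- polynomial identity in `m`, `A`, `B`.
    rw [eq_div_iff hm0, show a + 1 + (b + 1) - 1 = a + b + 1 by omega,
      pow_succ, pow_add, show ((m : ℚ) - 1) ^ a = m * pathCoeff m a - 1 by
        linarith, show ((m : ℚ) - 1) ^ b = m * pathCoeff m b - 1 by linarith]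
    ring
  · intro hne
    rw [eq_div_iff (mul_ne_zero hm0 hm1)]
    rcases Nat.even_or_odd a with hae | hao <;> rcases Nat.even_or_odd b with hbe | hbo
    · rw [hcast (dpColorFunction_edgeGluing_of_even_of_even hm ha hb h₁ h₂ hae hbe),
        hcast (dpColorFunction_cycleGraph_of_even (by omega) ha hae),
        hcast (dpColorFunction_cycleGraph_of_even (by omega) hb hbe)]
      push_cast
      ring
    · rw [hcast (dpColorFunction_edgeGluing_of_even_of_odd hm ha hb h₁ h₂ hae hbo),
        hcast (dpColorFunction_cycleGraph_of_even (by omega) ha hae),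
        hcast (dpColorFunction_cycleGraph_of_odd hm hb hbo)]
      push_cast
      ring
    · rw [hcast (dpColorFunction_edgeGluing_of_odd_of_even hm ha hb h₁ h₂ hao hbe),
        hcast (dpColorFunction_cycleGraph_of_odd hm ha hao),
        hcast (dpColorFunction_cycleGraph_of_even (by omega) hb hbe)]
      push_cast
      ring
    · exact absurd ⟨hao.add_one, hbo.add_one⟩ hne
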